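/- Let $n\ge 2$, let $A(x)$, $x\in\mathbb{R}^n$, be a $\mathbb{Z}^n$-periodic field of symmetric positive definite $n\times n$ matrices with smooth entries, let $V:\mathbb{R}^n\to\mathbb{R}$ be smooth and $\mathbb{Z}^n$-periodic, and put $H(x,p)=\frac12\langle A(x)p,p\rangle+V(x)$. For a continuous function $w:\mathbb{R}^n\to\mathbb{R}$ let $$D^{+}w(x)=\Big\{p\in\mathbb{R}^n:\limsup_{y\to x}\tfrac{w(y)-w(x)-\langle p,y-x\rangle}{|y-x|}\le 0\Big\},\qquad D^{-}w(x)=\Big\{p\in\mathbb{R}^n:\liminf_{y\to x}\tfrac{w(y)-w(x)-\langle p,y-x\rangle}{|y-x|}\ge 0\Big\},$$ and let $\Sigma_w$ be the set of all $x$ at which $D^+w(x)$ is not a singleton. For $c\in\mathbb{R}^n$ and $a\in\mathbb{R}$, a $\mathbb{Z}^n$-periodic viscosity solution of $H(x,c+Du(x))=a$ is a continuous $\mathbb{Z}^n$-periodic function $u:\mathbb{R}^n\to\mathbb{R}$ such that, for every $x$, $H(x,c+p)\le a$ for all $p\in D^+u(x)$ and $H(x,c+p)\ge a$ for all $p\in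 D^-u(x)$. Let $\alpha(c)$ be the unique constant $a$ for which such a solution exists (Mather's $\alpha$-function). Let $c\in\mathbb{R}^n$, let $u_c$ be a weak KAM solution, that is, a $\mathbb{Z}^n$-periodic viscosity solution of $H(x,c+Du(x))=\alpha(c)$, let $v(x)=u_c(x)+\langle c,x\rangle$, and assume that $\alpha(c)>\max V$. Then, for every $x\in\Sigma_v$, the following are equivalent: 1. $0\notin D^+v(x)$; 2. $x$ is not a local maximum point of $v$, and the level set $\Lambda_x=\{y\in\mathbb{R}^n: v(y)=v(x)\}$ is an $(n-1)$-dimensional Lipschitz submanifold near $x$, i.e. there are an invertible linear map $T:\mathbb{R}^n\to\mathbb{R}^{n-1}\times\mathbb{R}$, a neighbourhood $U$ of $x$ and a Lipschitz function $f:\mathbb{R}^{n-1}\to\mathbb{R}$ such that $\Lambda_x\cap U=U\cap T^{-1}(\operatorname{graph} f)$. -/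

import Mathlib

open scoped Topology ContDiff NNReal

namespace MechHJ

/-- The Euclidean space `ℝⁿ`. -/
abbrev E (n : ℕ) := EuclideanSpace ℝ (Fin n)

/-- `ℤⁿ`-periodicity of a function on `ℝⁿ`, that is, `f` descends to the torus `𝕋ⁿ = ℝⁿ / ℤⁿ`. -/
def IsZPeriodic {n : ℕ} {β : Type*} (f : E n → β) : Prop :=
  ∀ (x : E n) (k : Fin n → ℤ), f (x + WithLp.toLp 2 (fun i => (k i : ℝ))) = f x

/-- The (Dini) superdifferential `D⁺u(x)`: all `p` such that
`limsup_{y → x} (u y - u x - ⟪p, y - x⟫) / ‖y - x‖ ≤ 0`, the limsup condition being written out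
with `ε`. -/
def superdiff {n : ℕ} (u : E n → ℝ) (x : E n) : Set (E n) :=
  {p | ∀ ε : ℝ, 0 < ε → ∀ᶠ y in 𝓝 x, u y - u x - inner ℝ p (y - x) ≤ ε * ‖y - x‖}

/-- The (Dini) subdifferential `D⁻u(x)`: all `p` such that
`liminf_{y → x} (u y - u x - ⟪p, y - x⟫) / ‖y - x‖ ≥ 0`, the liminf condition being written out
with `ε`. -/
def subdiff {n : ℕ} (u : E n → ℝ) (x : E n) : Set (E n) :=
  {p | ∀ ε : ℝ, 0 < ε → ∀ᶠ y in 𝓝 x, -(ε * ‖y - x‖) ≤ u y - u x - inner ℝ p (y - x)}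

/-- The singular set `Σ_u`: the points where `D⁺u` is not a singleton. -/
def singularSet {n : ℕ} (u : E n → ℝ) : Set (E n) :=
  {x | ¬ ∃ p, superdiff u x = {p}}

/-- `A` is a smooth `ℤⁿ`-periodic Riemannian metric on `ℝⁿ`, given as a field of symmetric positive
definite matrices with smooth entries. -/
structure IsPeriodicMetric {n : ℕ} (A : E n → Matrix (Fin n) (Fin n) ℝ) : Prop where
  smooth : ∀ i j, ContDiff ℝ ∞ (fun x => A x i j)
  periodic : IsZPeriodic A
  posDef : ∀ x, (A x).PosDef

/-- The mechanical Hamiltonian `H(x, p) = ½ ⟨A(x) p, p⟩ + V(x)`. -/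
noncomputable def hamiltonian {n : ℕ} (A : E n → Matrix (Fin n) (Fin n) ℝ) (V : E n → ℝ)
    (x p : E n) : ℝ :=
  1 / 2 * inner ℝ (WithLp.toLp 2 ((A x).mulVec p.ofLp)) p + V x

/-- `u` is a (continuous) `ℤⁿ`-periodic viscosity solution of `H(x, c + Du(x)) = a`. -/
structure IsPeriodicViscositySolution {n : ℕ} (A : E n → Matrix (Fin n) (Fin n) ℝ) (V : E n → ℝ)
    (c : E n) (a : ℝ) (u : E n → ℝ) : Prop where
  continuous : Continuous u
  periodic : IsZPeriodic u
  subsolution : ∀ x, ∀ p ∈ superdiff u x, hamiltonian A V x (c + p) ≤ a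
  supersolution : ∀ x, ∀ p ∈ subdiff u x, a ≤ hamiltonian A V x (c + p)

/-- Mather's `α`-function: `α(c)` is the (unique) constant `a` such that `H(x, c + Du(x)) = a`
admits a `ℤⁿ`-periodic viscosity solution. -/
noncomputable def matherAlpha {n : ℕ} (A : E n → Matrix (Fin n) (Fin n) ℝ) (V : E n → ℝ)
    (c : E n) : ℝ :=
  Classical.epsilon fun a : ℝ => ∃ u : E n → ℝ, IsPeriodicViscositySolution A V c a u

/-- A weak KAM solution `u_c`: a `ℤⁿ`-periodic viscosity solution of `H(x, c + Du(x)) = α(c)`. -/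
def IsWeakKAMSolution {n : ℕ} (A : E n → Matrix (Fin n) (Fin n) ℝ) (V : E n → ℝ)
    (c : E n) (u : E n → ℝ) : Prop :=
  IsPeriodicViscositySolution A V c (matherAlpha A V c) u

/-- The level set `Λ_x = {y : v y = v x}`. -/
def levelSet {n : ℕ} (v : E n → ℝ) (x : E n) : Set (E n) :=
  {y | v y = v x}

/-- `S ⊆ ℝⁿ` is an `(n-1)`-dimensional Lipschitz submanifold near its point `x`: after an
invertible linear transformation `T : ℝⁿ → ℝⁿ⁻¹ × ℝ`, `S` coincides in a neighbourhood `U` of `x`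
with the graph of a Lipschitz function `f : ℝⁿ⁻¹ → ℝ`. -/
def IsLipschitzHypersurfaceNear {n : ℕ} (S : Set (E n)) (x : E n) : Prop :=
  x ∈ S ∧ ∃ T : E n ≃L[ℝ] (E (n - 1) × ℝ), ∃ U ∈ 𝓝 x, ∃ f : E (n - 1) → ℝ, ∃ K : ℝ≥0,
    LipschitzWith K f ∧ ∀ y ∈ U, (y ∈ S ↔ (T y).2 = f (T y).1)

end MechHJ

/-!
Write `a = α(c)`; then `v` is a viscosity solution of `H(x, Dv) = a` on all of `ℝⁿ`, and
`v - ⟪c, ·⟫` is periodic.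

The analytic core is that `v` is semiconcave with a linear modulus
(`IsLiftedSolution.exists_isSemiconcave`). It is obtained from the equation alone, by maximising
`v (z + w + h) + v (z + w - h) - 2 v z - √(M²‖h‖⁴ + N²‖w‖²)`, where periodicity supplies a maximum
point. The penalty depends on the three points only through `h` and `w`, so the momentum `q` at `z`
is exactly the mean of the momenta `q ± r` at the outer points. Uniform convexity of `H` in `p`
bounds `‖r‖²` by a multiple of `(1 + M)‖h‖²`, while the penalty gives `‖r‖ ≥ M‖h‖ / 2`: this is
absurd for large `M`, so the maximum is not positive, and `w = 0` is the claim.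

Semiconcavity makes superdifferentials nonempty, gives the upper bound
`v (y + h) ≤ v y + ⟪p, h⟫ + C / 2 ‖h‖²` for `p ∈ D⁺v(y)` with a uniform constant, and makes the
graph of `D⁺v` closed. Now let `0 ∉ D⁺v(x)`. Then `x` is no local maximum point, and one hyperplane
separates `0` from `D⁺v(y)` for all `y` near `x`, so `v` increases at a definite rate in a fixed
direction and its level set is a Lipschitz graph (`IsSemiconcave.isLipschitzHypersurfaceNear`).

Conversely, let `x` be no local maximum point and the level set a Lipschitz graph near `x`. Each
side of the graph is connected, so `v > v x` on one whole side, in particular on an open cone with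
vertex `x` (`exists_cone_lt_of_isLipschitzHypersurfaceNear`). If `0 ∈ D⁺v(x)`, gradients taken along
the axis `e` of the cone accumulate at some `p ∈ D⁺v(x)` with `⟪p, e⟫ ≤ 0`, and `v > v x` on the
cone gives `⟪p, d⟫ ≥ 0` for `d` near `e`, whence `p = 0`; but `H(x, p) ≥ a > V(x) = H(x, 0)`
(`IsSemiconcave.zero_notMem_superdiff_of_cone`, `IsLiftedSolution.ne_zero_of_tendsto`).
-/

open Filter Metric

namespace MechHJ

/-! ### Dini differentials and semiconcave functions -/

section Differentials

variable {n : ℕ} {v : E n → ℝ}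

/-- The gradient of a test function that touches `v` from above is a supergradient. -/
theorem mem_superdiff_of_hasFDerivAt {x p : E n} {g : E n → ℝ}
    (hg : HasFDerivAt g (innerSL ℝ p) 0) (h : ∀ᶠ d in 𝓝 0, v (x + d) - v x ≤ g d - g 0) :
    p ∈ superdiff v x := by
  intro ε hε
  have h1 := (hg.isLittleO.def hε).and h
  have h2 : Tendsto (fun y => y - x) (𝓝 x) (𝓝 0) := by
    have : Continuous fun y : E n => y - x := by fun_prop
    simpa using this.tendsto x
  filter_upwards [h2.eventually h1] with y hy
  obtain ⟨hy1, hy2⟩ := hy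
  rw [add_sub_cancel] at hy2
  simp only [sub_zero, innerSL_apply_apply, Real.norm_eq_abs] at hy1
  have := (abs_le.1 hy1).2
  linarith

theorem neg_mem_superdiff_neg {x p : E n} :
    -p ∈ superdiff (fun y => -v y) x ↔ p ∈ subdiff v x := by
  refine forall₂_congr fun ε _ => eventually_congr (Eventually.of_forall fun y => ?_)
  rw [inner_neg_left]
  constructor <;> intro h <;> linarith

theorem mem_subdiff_of_hasFDerivAt {x p : E n} {g : E n → ℝ}
    (hg : HasFDerivAt g (innerSL ℝ p) 0) (h : ∀ᶠ d in 𝓝 0, g d - g 0 ≤ v (x + d) - v x) :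
    p ∈ subdiff v x := by
  rw [← neg_mem_superdiff_neg]
  refine mem_superdiff_of_hasFDerivAt (g := fun d => -g d) ?_ ?_
  · rw [map_neg]; exact hg.neg
  · filter_upwards [h] with d hd; linarith

theorem zero_mem_superdiff_of_isLocalMax {x : E n} (h : IsLocalMax v x) : 0 ∈ superdiff v x := by
  intro ε hε
  filter_upwards [h] with y hy
  have : 0 ≤ ε * ‖y - x‖ := by positivity
  simp only [inner_zero_left]
  linarith

theorem convex_superdiff (x : E n) : Convex ℝ (superdiff v x) := by
  intro p hp q hq s t hs ht hst ε hε
  filter_upwards [hp ε hε, hq ε hε] with y h1 h2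
  rw [inner_add_left, inner_smul_left, inner_smul_left]
  simp only [conj_trivial]
  have e : v y - v x - (s * inner ℝ p (y - x) + t * inner ℝ q (y - x))
      = s * (v y - v x - inner ℝ p (y - x)) + t * (v y - v x - inner ℝ q (y - x)) := by
    linear_combination -(v y - v x) * hst
  rw [e]
  calc _ ≤ s * (ε * ‖y - x‖) + t * (ε * ‖y - x‖) := by gcongr
    _ = _ := by rw [← add_mul, hst, one_mul]

/-- Subgradients exist near every point: minimise `v + k‖· - y‖²` over a small closed ball, with
`k` so large that the minimum is not attained on the boundary sphere. -/
theorem exists_mem_subdiff_near (hv : Continuous v) (y : E n) {ε : ℝ} (hε : 0 < ε) :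
    ∃ z ∈ ball y ε, (subdiff v z).Nonempty := by
  obtain ⟨ρ, hρ, hρε⟩ := exists_between hε
  have hK : IsCompact (closedBall y ρ) := isCompact_closedBall y ρ
  obtain ⟨b, hb⟩ := (hK.image hv).bddBelow
  have hb' : ∀ z ∈ closedBall y ρ, b ≤ v z := fun z hz => hb ⟨z, hz, rfl⟩
  set k : ℝ := (v y - b + 1) / ρ ^ 2 with hk
  have hkρ : k * ρ ^ 2 = v y - b + 1 := by rw [hk]; field_simp
  obtain ⟨z, hz, hmin⟩ := hK.exists_isMinOn (f := fun z => v z + k * ‖z - y‖ ^ 2)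
    ⟨y, mem_closedBall_self hρ.le⟩ (by fun_prop)
  have hzy := hmin (mem_closedBall_self hρ.le)
  simp only [Set.mem_ofPred_eq, sub_self, norm_zero] at hzy
  have hzρ : z ∈ ball y ρ := by
    rw [mem_ball, dist_eq_norm]
    rw [mem_closedBall, dist_eq_norm] at hz
    refine lt_of_le_of_ne hz fun h => ?_
    rw [h, hkρ] at hzy
    have := hb' z (by rw [mem_closedBall, dist_eq_norm, h])
    linarith
  refine ⟨z, ball_subset_ball hρε.le hzρ, (-(2 * k)) • (z - y), ?_⟩
  refine mem_subdiff_of_hasFDerivAt (g := fun d => -(k * ‖(z - y) + d‖ ^ 2)) ?_ ?_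
  · have h1 : HasFDerivAt (fun d : E n => (z - y) + d) (ContinuousLinearMap.id ℝ (E n)) 0 :=
      (hasFDerivAt_id 0).const_add _
    refine ((h1.norm_sq).const_mul k).fun_neg.congr_fderiv ?_
    ext d
    simp
    ring
  · have : ∀ᶠ d in 𝓝 (0 : E n), z + d ∈ ball y ρ := by
      have hc : Tendsto (fun d : E n => z + d) (𝓝 0) (𝓝 z) := by
        have : Continuous fun d : E n => z + d := by fun_prop
        simpa using this.tendsto 0
      exact hc.eventually (isOpen_ball.mem_nhds hzρ)
    filter_upwards [this] with d hd
    have := hmin (ball_subset_closedBall hd)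
    simp only [Set.mem_ofPred_eq] at this
    rw [show z + d - y = z - y + d by abel] at this
    simp only [add_zero]
    linarith

theorem mem_superdiff_of_le {K : ℝ} {y p : E n}
    (h : ∀ d, v (y + d) ≤ v y + inner ℝ p d + K * ‖d‖ ^ 2) : p ∈ superdiff v y := by
  refine mem_superdiff_of_hasFDerivAt (g := fun d => inner ℝ p d + K * ‖d‖ ^ 2) ?_ ?_
  · have h1 : HasFDerivAt (fun d : E n => inner ℝ p d) (innerSL ℝ p) 0 :=
      (innerSL ℝ p).hasFDerivAt
    simpa using h1.fun_add (((hasFDerivAt_id (0 : E n)).norm_sq).const_mul K)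
  · refine Eventually.of_forall fun d => ?_
    have := h d
    simp only [inner_zero_right, norm_zero]
    linarith

/-- `v` is semiconcave with linear modulus and constant `C`, in midpoint form. -/
def IsSemiconcave (C : ℝ) (v : E n → ℝ) : Prop :=
  ∀ z h, v (z + h) + v (z - h) - 2 * v z ≤ C * ‖h‖ ^ 2

namespace IsSemiconcave

variable {C : ℝ}

/-- The quadratic upper bound at a supergradient. The defect
`g h = v (y + h) - v y - ⟪p, h⟫ - C / 2 * ‖h‖²` satisfies `g h ≤ 2 * g (h / 2)`, hence
`g h ≤ 2 ^ k * g (h / 2 ^ k)`, which tends to a nonpositive limit. -/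
theorem le_of_mem_superdiff (hC : IsSemiconcave C v) (hC0 : 0 ≤ C) {y p : E n}
    (hp : p ∈ superdiff v y) (h : E n) :
    v (y + h) ≤ v y + inner ℝ p h + C / 2 * ‖h‖ ^ 2 := by
  set g : E n → ℝ := fun h => v (y + h) - v y - inner ℝ p h - C / 2 * ‖h‖ ^ 2 with hg
  have half : ∀ h, g h ≤ 2 * g ((1 / 2 : ℝ) • h) := by
    intro h
    have h1 := hC (y + (1 / 2 : ℝ) • h) ((1 / 2 : ℝ) • h)
    rw [show y + (1 / 2 : ℝ) • h + (1 / 2 : ℝ) • h = y + h by module,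
      show y + (1 / 2 : ℝ) • h - (1 / 2 : ℝ) • h = y by module] at h1
    simp only [hg, inner_smul_right, norm_smul, mul_pow] at h1 ⊢
    norm_num at h1 ⊢
    linarith
  have iter : ∀ k : ℕ, g h ≤ 2 ^ k * g (((1 / 2 : ℝ) ^ k) • h) := by
    intro k
    induction k with
    | zero => simp
    | succ k ih =>
      refine ih.trans ?_
      have := half (((1 / 2 : ℝ) ^ k) • h)
      rw [smul_smul, ← pow_succ'] at this
      calc _ ≤ 2 ^ k * (2 * g (((1 / 2 : ℝ) ^ (k + 1)) • h)) := by gcongr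
        _ = _ := by ring
  have lim : Tendsto (fun k : ℕ => y + ((1 / 2 : ℝ) ^ k) • h) atTop (𝓝 y) := by
    have h1 : Tendsto (fun k : ℕ => (1 / 2 : ℝ) ^ k) atTop (𝓝 0) :=
      tendsto_pow_atTop_nhds_zero_of_lt_one (by norm_num) (by norm_num)
    simpa using (h1.smul_const h).const_add y
  have key : ∀ ε : ℝ, 0 < ε → g h ≤ 0 + ε * ‖h‖ := by
    intro ε hε
    obtain ⟨k, hk⟩ := (lim.eventually (hp ε hε)).exists
    rw [add_sub_cancel_left] at hk
    have h2 : g (((1 / 2 : ℝ) ^ k) • h) ≤ ε * ‖((1 / 2 : ℝ) ^ k) • h‖ := by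
      have : 0 ≤ C / 2 * ‖((1 / 2 : ℝ) ^ k) • h‖ ^ 2 := by positivity
      simp only [hg]
      linarith
    rw [norm_smul, norm_pow, Real.norm_of_nonneg (by norm_num : (0 : ℝ) ≤ 1 / 2)] at h2
    calc g h ≤ 2 ^ k * g (((1 / 2 : ℝ) ^ k) • h) := iter k
      _ ≤ 2 ^ k * (ε * ((1 / 2) ^ k * ‖h‖)) := by gcongr
      _ = (2 * (1 / 2)) ^ k * (ε * ‖h‖) := by rw [mul_pow]; ring
      _ = 0 + ε * ‖h‖ := by norm_num
  have : g h ≤ 0 := by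
    have ht : Tendsto (fun ε : ℝ => 0 + ε * ‖h‖) (𝓝[>] 0) (𝓝 (0 + 0 * ‖h‖)) :=
      ((continuous_const.add (continuous_id.mul continuous_const)).tendsto 0).mono_left
        nhdsWithin_le_nhds
    rw [zero_mul, add_zero] at ht
    exact ge_of_tendsto ht (eventually_mem_nhdsWithin.mono fun ε hε => key ε hε)
  simp only [hg] at this
  linarith

/-- The midpoint inequality reflects the lower bound at `y - h` into an upper bound at `y + h`. -/
theorem subdiff_subset_superdiff (hC : IsSemiconcave C v) (y : E n) :
    subdiff v y ⊆ superdiff v y := by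
  intro p hp ε hε
  have hrefl : Tendsto (fun z : E n => y - (z - y)) (𝓝 y) (𝓝 y) := by
    have : Continuous fun z : E n => y - (z - y) := by fun_prop
    simpa using this.tendsto y
  have hsmall : ∀ᶠ z in 𝓝 y, C * ‖z - y‖ < ε / 2 := by
    have : Continuous fun z : E n => C * ‖z - y‖ := by fun_prop
    exact (this.tendsto y).eventually (gt_mem_nhds (by simpa using hε))
  filter_upwards [hrefl.eventually (hp (ε / 2) (half_pos hε)), hsmall] with z h1 h2
  have h3 := hC y (z - y)
  rw [sub_sub_cancel_left, norm_neg, inner_neg_right] at h1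
  rw [add_sub_cancel] at h3
  have h4 : C * ‖z - y‖ ^ 2 ≤ ε / 2 * ‖z - y‖ := by
    rw [pow_two, ← mul_assoc]; gcongr
  linarith

/-- The superdifferential of a semiconcave function has closed graph. -/
theorem mem_superdiff_of_tendsto (hC : IsSemiconcave C v) (hC0 : 0 ≤ C) (hv : Continuous v)
    {y p : E n} {ys ps : ℕ → E n} (hps : ∀ k, ps k ∈ superdiff v (ys k))
    (hy : Tendsto ys atTop (𝓝 y)) (hp : Tendsto ps atTop (𝓝 p)) : p ∈ superdiff v y := by
  refine mem_superdiff_of_le (K := C / 2) fun d => ?_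
  refine le_of_tendsto_of_tendsto' (b := atTop) ?_ ?_
    fun k => hC.le_of_mem_superdiff hC0 (hps k) d
  · exact (hv.tendsto _).comp (hy.add_const d)
  · exact ((((hv.tendsto _).comp hy).add (hp.inner tendsto_const_nhds)).add_const _)

/-- Bounded supergradients at points converging to `y` accumulate at a supergradient at `y`. -/
theorem exists_tendsto_mem_superdiff (hC : IsSemiconcave C v) (hC0 : 0 ≤ C) (hv : Continuous v)
    {R : ℝ} (hR : ∀ y, ∀ p ∈ superdiff v y, ‖p‖ ≤ R) {y : E n} {ys ps : ℕ → E n}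
    (hps : ∀ k, ps k ∈ superdiff v (ys k)) (hy : Tendsto ys atTop (𝓝 y)) :
    ∃ p ∈ superdiff v y, ∃ φ : ℕ → ℕ, StrictMono φ ∧ Tendsto (ps ∘ φ) atTop (𝓝 p) := by
  obtain ⟨p, -, φ, hφ, hlim⟩ := tendsto_subseq_of_bounded (x := ps) (s := closedBall 0 R)
    isBounded_closedBall (fun k => by simpa using hR _ _ (hps k))
  exact ⟨p, hC.mem_superdiff_of_tendsto hC0 hv (fun k => hps (φ k))
    (hy.comp hφ.tendsto_atTop) hlim, φ, hφ, hlim⟩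

/-- Subgradients exist at points arbitrarily close to `y`; they are supergradients as well, and
accumulate at a supergradient at `y`. -/
theorem superdiff_nonempty (hC : IsSemiconcave C v) (hC0 : 0 ≤ C) (hv : Continuous v)
    {R : ℝ} (hR : ∀ y, ∀ p ∈ superdiff v y, ‖p‖ ≤ R) (y : E n) : (superdiff v y).Nonempty := by
  choose ys hys ps hps using fun k : ℕ =>
    exists_mem_subdiff_near hv y (ε := 1 / ((k : ℝ) + 1)) (by positivity)
  have hlim : Tendsto ys atTop (𝓝 y) := by
    rw [tendsto_iff_dist_tendsto_zero]
    exact squeeze_zero (fun _ => dist_nonneg) (fun k => (mem_ball.1 (hys k)).le)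
      tendsto_one_div_add_atTop_nhds_zero_nat
  obtain ⟨p, hp, -⟩ := hC.exists_tendsto_mem_superdiff hC0 hv hR
    (fun k => hC.subdiff_subset_superdiff _ (hps k)) hlim
  exact ⟨p, hp⟩

end IsSemiconcave

end Differentials

/-! ### Periodic fields and the mechanical Hamiltonian -/

section Hamiltonian

variable {n : ℕ}

/-- A compact set whose translates by `ℤⁿ` cover `ℝⁿ`. -/
theorem exists_isCompact_fundamental (n : ℕ) : ∃ K : Set (E n), IsCompact K ∧
    ∀ x, ∃ k : Fin n → ℤ, x + WithLp.toLp 2 (fun i => (k i : ℝ)) ∈ K := by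
  refine ⟨WithLp.toLp 2 '' (Set.univ.pi fun _ => Set.Icc (0 : ℝ) 1),
    (isCompact_univ_pi fun _ => isCompact_Icc).image (PiLp.continuous_toLp 2 _), fun x => ?_⟩
  refine ⟨fun i => -⌊x i⌋, fun i => Int.fract (x i), fun i _ => ?_, ?_⟩
  · exact ⟨Int.fract_nonneg _, (Int.fract_lt_one _).le⟩
  · ext i
    simp [Int.fract, sub_eq_add_neg]

theorem IsZPeriodic.exists_norm_le {G : Type*} [SeminormedAddCommGroup G] {f : E n → G}
    (hf : IsZPeriodic f) (hc : Continuous f) : ∃ B : ℝ, 0 ≤ B ∧ ∀ x, ‖f x‖ ≤ B := by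
  obtain ⟨K, hK, hcov⟩ := exists_isCompact_fundamental n
  obtain ⟨B, hB⟩ := (hK.image hc.norm).bddAbove
  refine ⟨max B 0, le_max_right _ _, fun x => ?_⟩
  obtain ⟨k, hk⟩ := hcov x
  rw [← hf x k]
  exact (hB ⟨_, hk, rfl⟩).trans (le_max_left _ _)

theorem IsZPeriodic.fderiv {G : Type*} [NormedAddCommGroup G] [NormedSpace ℝ G] {f : E n → G}
    (hf : IsZPeriodic f) : IsZPeriodic (fderiv ℝ f) := by
  intro x k
  rw [← fderiv_comp_add_right]
  congr 1
  funext y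
  exact hf y k

/-- A smooth periodic map is Lipschitz, and its second differences along three nearly equidistant
collinear points are quadratically small. -/
theorem IsZPeriodic.exists_second_difference_le {G : Type*} [NormedAddCommGroup G]
    [NormedSpace ℝ G] {f : E n → G} (hf : IsZPeriodic f) (hs : ContDiff ℝ ∞ f) :
    ∃ C : ℝ, 0 ≤ C ∧ (∀ x y, ‖f x - f y‖ ≤ C * ‖x - y‖) ∧
      ∀ z h w, ‖f (z + w + h) + f (z + w - h) - (2 : ℝ) • f z‖ ≤ C * (‖h‖ ^ 2 + ‖w‖) := by
  have hd : Differentiable ℝ f := hs.differentiable (by simp)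
  have hs' : ContDiff ℝ ∞ (_root_.fderiv ℝ f) := hs.fderiv_right (by simp)
  have hd' : Differentiable ℝ (_root_.fderiv ℝ f) := hs'.differentiable (by simp)
  obtain ⟨B₁, hB₁0, hB₁⟩ := hf.fderiv.exists_norm_le hs'.continuous
  obtain ⟨B₂, hB₂0, hB₂⟩ := hf.fderiv.fderiv.exists_norm_le
    (hs'.continuous_fderiv (by simp))
  have lip : ∀ x y, ‖f x - f y‖ ≤ B₁ * ‖x - y‖ := fun x y =>
    convex_univ.norm_image_sub_le_of_norm_fderiv_le (fun z _ => hd z) (fun z _ => hB₁ z)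
      (Set.mem_univ y) (Set.mem_univ x)
  have lip' : ∀ x y, ‖_root_.fderiv ℝ f x - _root_.fderiv ℝ f y‖ ≤ B₂ * ‖x - y‖ := fun x y =>
    convex_univ.norm_image_sub_le_of_norm_fderiv_le (fun z _ => hd' z) (fun z _ => hB₂ z)
      (Set.mem_univ y) (Set.mem_univ x)
  have taylor : ∀ m h, ‖f (m + h) - f m - _root_.fderiv ℝ f m h‖ ≤ B₂ * ‖h‖ ^ 2 := by
    intro m h
    have := (convex_closedBall m ‖h‖).norm_image_sub_le_of_norm_fderiv_le' (𝕜 := ℝ) (f := f)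
      (C := B₂ * ‖h‖) (φ := _root_.fderiv ℝ f m) (x := m) (y := m + h) (fun z _ => hd z)
      (fun z hz => (lip' z m).trans (by
        rw [mem_closedBall, dist_eq_norm] at hz; gcongr)) (by simp) (by simp)
    rw [add_sub_cancel_left] at this
    calc _ ≤ B₂ * ‖h‖ * ‖h‖ := this
      _ = _ := by ring
  refine ⟨2 * B₁ + 2 * B₂, by positivity, fun x y => (lip x y).trans ?_, fun z h w => ?_⟩
  · gcongr; linarith
  · have h1 := taylor (z + w) h
    have h2 := taylor (z + w) (-h)
    have h3 := lip (z + w) z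
    rw [norm_neg, map_neg, ← sub_eq_add_neg] at h2
    rw [add_sub_cancel_left] at h3
    have e : f (z + w + h) + f (z + w - h) - (2 : ℝ) • f z
        = (f (z + w + h) - f (z + w) - _root_.fderiv ℝ f (z + w) h)
          + (f (z + w - h) - f (z + w) - -_root_.fderiv ℝ f (z + w) h)
          + (2 : ℝ) • (f (z + w) - f z) := by module
    rw [e]
    have h4 := norm_add₃_le (a := f (z + w + h) - f (z + w) - _root_.fderiv ℝ f (z + w) h)
      (b := f (z + w - h) - f (z + w) - -_root_.fderiv ℝ f (z + w) h)
      (c := (2 : ℝ) • (f (z + w) - f z))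
    rw [norm_smul, Real.norm_two] at h4
    have : 0 ≤ B₁ * ‖h‖ ^ 2 := by positivity
    have : 0 ≤ B₂ * ‖w‖ := by positivity
    linarith

/-- The matrix field as a field of operators on `ℝⁿ` with the Euclidean norm. -/
noncomputable def metricOp (A : E n → Matrix (Fin n) (Fin n) ℝ) (x : E n) : E n →L[ℝ] E n :=
  Matrix.toEuclideanCLM (𝕜 := ℝ) (A x)

variable {A : E n → Matrix (Fin n) (Fin n) ℝ} {V : E n → ℝ}

theorem hamiltonian_eq (x p : E n) :
    hamiltonian A V x p = 1 / 2 * inner ℝ (metricOp A x p) p + V x := rfl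

namespace IsPeriodicMetric

theorem contDiff_metricOp (hA : IsPeriodicMetric A) : ContDiff ℝ ∞ (metricOp A) := by
  let L : (Fin n → Fin n → ℝ) →ₗ[ℝ] (E n →L[ℝ] E n) :=
    { toFun := fun M => Matrix.toEuclideanCLM (𝕜 := ℝ) (Matrix.of M)
      map_add' := fun M N => map_add (Matrix.toEuclideanCLM (n := Fin n) (𝕜 := ℝ)) _ _
      map_smul' := fun r M => map_smul (Matrix.toEuclideanCLM (n := Fin n) (𝕜 := ℝ)) r _ }
  have h : ContDiff ℝ ∞ fun x => (fun i j => A x i j : Fin n → Fin n → ℝ) :=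
    contDiff_pi.2 fun i => contDiff_pi.2 fun j => hA.smooth i j
  exact L.toContinuousLinearMap.contDiff.comp h

theorem isZPeriodic_metricOp (hA : IsPeriodicMetric A) : IsZPeriodic (metricOp A) := by
  intro x k
  simp only [metricOp, hA.periodic x k]

theorem inner_metricOp_comm (hA : IsPeriodicMetric A) (x p q : E n) :
    inner ℝ (metricOp A x p) q = inner ℝ (metricOp A x q) p := by
  have h := (hA.posDef x).isHermitian
  rw [real_inner_comm, real_inner_comm p]
  simp only [metricOp, Matrix.inner_toEuclideanCLM]
  have ht : (A x).transpose = A x := by simpa [Matrix.IsHermitian] using h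
  rw [Matrix.dotProduct_mulVec, ← Matrix.mulVec_transpose, ht, dotProduct_comm]

theorem inner_metricOp_pos (hA : IsPeriodicMetric A) (x : E n) {p : E n} (hp : p ≠ 0) :
    0 < inner ℝ (metricOp A x p) p := by
  rw [real_inner_comm]
  simp only [metricOp, Matrix.inner_toEuclideanCLM]
  have := (hA.posDef x).dotProduct_mulVec_pos (x := p.ofLp) (by simpa using hp)
  simpa using this

/-- Uniform ellipticity, by compactness of the torus and of the unit sphere. -/
theorem exists_elliptic (hA : IsPeriodicMetric A) :
    ∃ l : ℝ, 0 < l ∧ ∀ x p, l * ‖p‖ ^ 2 ≤ inner ℝ (metricOp A x p) p := by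
  obtain ⟨K, hK, hcov⟩ := exists_isCompact_fundamental n
  have hc : Continuous (metricOp A) := hA.contDiff_metricOp.continuous
  obtain ⟨l, hl, hle⟩ := (hK.prod (isCompact_sphere (0 : E n) 1)).exists_forall_le' (a := 0)
    (f := fun y : E n × E n => inner ℝ (metricOp A y.1 y.2) y.2)
    (by
      refine Continuous.continuousOn ?_
      exact ((hc.comp continuous_fst).clm_apply continuous_snd).inner continuous_snd)
    (by
      rintro ⟨y, p⟩ ⟨-, hp⟩
      exact hA.inner_metricOp_pos y (ne_zero_of_mem_unit_sphere ⟨p, hp⟩))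
  refine ⟨l, hl, fun x p => ?_⟩
  obtain ⟨k, hk⟩ := hcov x
  rw [← hA.isZPeriodic_metricOp x k]
  rcases eq_or_ne p 0 with rfl | hp
  · simp
  · have hp' : 0 < ‖p‖ := norm_pos_iff.2 hp
    have := hle ⟨_, ‖p‖⁻¹ • p⟩ ⟨hk, by simp [norm_smul, hp'.ne']⟩
    simp only [map_smul, inner_smul_left, inner_smul_right, conj_trivial] at this
    calc l * ‖p‖ ^ 2 ≤ (‖p‖⁻¹ * (‖p‖⁻¹ * _)) * ‖p‖ ^ 2 := by gcongr
      _ = _ := by field_simp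

/-- The sublevel sets of the Hamiltonian are bounded, uniformly in `x`. -/
theorem exists_norm_le_of_hamiltonian_le (hA : IsPeriodicMetric A) (hV : Continuous V)
    (hVper : IsZPeriodic V) (a : ℝ) :
    ∃ R : ℝ, ∀ x p, hamiltonian A V x p ≤ a → ‖p‖ ≤ R := by
  obtain ⟨l, hl, hell⟩ := hA.exists_elliptic
  obtain ⟨B, hB0, hB⟩ := hVper.exists_norm_le hV
  refine ⟨Real.sqrt (2 * (a + B) / l), fun x p hp => Real.le_sqrt_of_sq_le ?_⟩
  rw [hamiltonian_eq] at hp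
  have h1 := hell x p
  have h2 := (abs_le.1 (hB x)).1
  rw [le_div_iff₀ hl]
  linarith

/-- Uniform convexity of the Hamiltonian in `p`, combined with its regularity in `x`: if
`q + r` and `q - r` are subsolution momenta at two points placed almost symmetrically about a
point where `q` is a supersolution momentum, then `‖r‖²` is controlled. -/
theorem exists_sq_norm_le (hA : IsPeriodicMetric A) (hV : ContDiff ℝ ∞ V)
    (hVper : IsZPeriodic V) : ∃ l C : ℝ, 0 < l ∧ 0 ≤ C ∧ ∀ (a : ℝ) (z h w q r : E n),
      hamiltonian A V (z + w + h) (q + r) ≤ a → hamiltonian A V (z + w - h) (q - r) ≤ a →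
      a ≤ hamiltonian A V z q →
      l * ‖r‖ ^ 2 ≤ C * ((‖h‖ ^ 2 + ‖w‖) * (‖q‖ ^ 2 + 1) + ‖h‖ * ‖q‖ * ‖r‖) := by
  obtain ⟨l, hl, hell⟩ := hA.exists_elliptic
  obtain ⟨C₁, hC₁0, hlip, hA2⟩ :=
    hA.isZPeriodic_metricOp.exists_second_difference_le hA.contDiff_metricOp
  obtain ⟨C₂, hC₂0, -, hV2⟩ := hVper.exists_second_difference_le hV
  refine ⟨l, 2 * (C₁ + C₂), hl, by positivity, fun a z h w q r hx hy hz => ?_⟩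
  have hquad : ∀ (T : E n →L[ℝ] E n) (b c : E n), |inner ℝ (T b) c| ≤ ‖T‖ * ‖b‖ * ‖c‖ :=
    fun T b c => (abs_real_inner_le_norm _ _).trans (by gcongr; exact T.le_opNorm b)
  have e1 := (hquad (metricOp A (z + w + h) + metricOp A (z + w - h)
    - (2 : ℝ) • metricOp A z) q q).trans
      (mul_le_mul_of_nonneg_right (mul_le_mul_of_nonneg_right (hA2 z h w) (norm_nonneg q))
        (norm_nonneg q))
  have e2 := (hquad (metricOp A (z + w + h) - metricOp A (z + w - h)) q r).trans
      (mul_le_mul_of_nonneg_right (mul_le_mul_of_nonneg_right (hlip _ _) (norm_nonneg q))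
        (norm_nonneg r))
  have e3 := hV2 z h w
  have e4 := hell (z + w + h) r
  have e5 := hell (z + w - h) r
  have s1 := hA.inner_metricOp_comm (z + w + h) q r
  have s2 := hA.inner_metricOp_comm (z + w - h) q r
  rw [show z + w + h - (z + w - h) = (2 : ℝ) • h by module, norm_smul, Real.norm_two] at e2
  rw [hamiltonian_eq] at hx hy hz
  simp only [map_add, map_sub, inner_add_left, inner_add_right, inner_sub_left,
    inner_sub_right, add_apply, sub_apply,
    smul_apply, inner_smul_left, conj_trivial] at hx hy hz e1 e2
  rw [smul_eq_mul, Real.norm_eq_abs] at e3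
  have f1 := (abs_le.1 e1).1
  have f2 := (abs_le.1 e2).1
  have f3 := (abs_le.1 e3).1
  have g1 : 0 ≤ C₂ * (‖h‖ ^ 2 + ‖w‖) * ‖q‖ * ‖q‖ := by positivity
  have g2 : 0 ≤ C₁ * (‖h‖ ^ 2 + ‖w‖) := by positivity
  have g3 : 0 ≤ C₂ * ‖h‖ * ‖q‖ * ‖r‖ := by positivity
  have g4 : 0 ≤ C₁ * (‖h‖ ^ 2 + ‖w‖) * ‖q‖ * ‖q‖ := by positivity
  have g5 : 0 ≤ C₂ * (‖h‖ ^ 2 + ‖w‖) := by positivity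
  nlinarith

end IsPeriodicMetric

end Hamiltonian

/-! ### Semiconcavity of viscosity solutions -/

section Solutions

variable {n : ℕ} {A : E n → Matrix (Fin n) (Fin n) ℝ} {V : E n → ℝ} {c : E n} {a : ℝ}
  {u v : E n → ℝ}

/-- `v` is a viscosity solution of `H(x, Dv(x)) = a` on `ℝⁿ` such that `v - ⟪c, ·⟫` is
`ℤⁿ`-periodic. -/
structure IsLiftedSolution (A : E n → Matrix (Fin n) (Fin n) ℝ) (V : E n → ℝ) (c : E n) (a : ℝ)
    (v : E n → ℝ) : Prop where
  continuous : Continuous v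
  periodic : IsZPeriodic fun x => v x - inner ℝ c x
  subsolution : ∀ x, ∀ p ∈ superdiff v x, hamiltonian A V x p ≤ a
  supersolution : ∀ x, ∀ p ∈ subdiff v x, a ≤ hamiltonian A V x p

theorem IsPeriodicViscositySolution.isLiftedSolution
    (hu : IsPeriodicViscositySolution A V c a u) (hv : ∀ y, v y = u y + inner ℝ c y) :
    IsLiftedSolution A V c a v := by
  obtain rfl : v = fun y => u y + inner ℝ c y := funext hv
  have key : ∀ x y p : E n, u y - u x - inner ℝ (p - c) (y - x)
      = u y + inner ℝ c y - (u x + inner ℝ c x) - inner ℝ p (y - x) := by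
    intro x y p
    rw [inner_sub_left, inner_sub_right c]
    ring
  refine ⟨hu.continuous.add (by fun_prop), ?_, fun x p hp => ?_, fun x p hp => ?_⟩
  · simpa using hu.periodic
  · have := hu.subsolution x (p - c) fun ε hε => (hp ε hε).mono fun y hy => by rwa [key]
    rwa [add_sub_cancel] at this
  · have := hu.supersolution x (p - c) fun ε hε => (hp ε hε).mono fun y hy => by rwa [key]
    rwa [add_sub_cancel] at this

/-- The penalty `√(M²‖h‖⁴ + N²‖w‖²)`, which grows quadratically in `h` and linearly in `w`. -/
noncomputable def penalty (M N : ℝ) (h w : E n) : ℝ :=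
  Real.sqrt (M ^ 2 * (‖h‖ ^ 2) ^ 2 + N ^ 2 * ‖w‖ ^ 2)

theorem continuous_penalty (M N : ℝ) :
    Continuous fun y : E n × E n => penalty M N y.1 y.2 := by
  unfold penalty
  fun_prop

theorem le_penalty_left (M N : ℝ) (h w : E n) : M * ‖h‖ ^ 2 ≤ penalty M N h w := by
  refine Real.le_sqrt_of_sq_le ?_
  rw [mul_pow]
  have : 0 ≤ N ^ 2 * ‖w‖ ^ 2 := by positivity
  linarith

theorem le_penalty_right (M N : ℝ) (h w : E n) : N * ‖w‖ ≤ penalty M N h w := by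
  refine Real.le_sqrt_of_sq_le ?_
  rw [mul_pow]
  have : 0 ≤ M ^ 2 * (‖h‖ ^ 2) ^ 2 := by positivity
  linarith

theorem penalty_le {M N : ℝ} (hM : 0 ≤ M) (hN : 0 ≤ N) (h w : E n) :
    penalty M N h w ≤ M * ‖h‖ ^ 2 + N * ‖w‖ := by
  refine Real.sqrt_le_iff.2 ⟨by positivity, ?_⟩
  have : 0 ≤ M * ‖h‖ ^ 2 * (N * ‖w‖) := by positivity
  nlinarith

theorem hasFDerivAt_penalty {M N : ℝ} {h w : E n} (hpos : 0 < penalty M N h w) (α β : ℝ) :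
    HasFDerivAt (fun d => penalty M N (h + α • d) (w + β • d))
      (innerSL ℝ ((α * (2 * M ^ 2 * ‖h‖ ^ 2 / penalty M N h w)) • h
        + (β * (N ^ 2 / penalty M N h w)) • w)) 0 := by
  have h1 : ∀ (b : E n) (t : ℝ), HasFDerivAt (fun d : E n => b + t • d)
      (t • ContinuousLinearMap.id ℝ (E n)) 0 :=
    fun b t => ((hasFDerivAt_id 0).fun_const_smul t).const_add _
  have h2 := (((h1 h α).norm_sq.pow 2).const_mul (M ^ 2)).fun_add
    ((h1 w β).norm_sq.const_mul (N ^ 2))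
  have h3 : M ^ 2 * (‖h + α • (0 : E n)‖ ^ 2) ^ 2 + N ^ 2 * ‖w + β • (0 : E n)‖ ^ 2 ≠ 0 := by
    simpa using (Real.sqrt_pos.1 hpos).ne'
  refine (h2.sqrt h3).congr_fderiv ?_
  ext d
  simp only [smul_zero, add_zero]
  change _ = innerSL ℝ _ d
  have : penalty M N h w ≠ 0 := hpos.ne'
  rw [← penalty]
  simp
  field_simp

/-- The doubling functional, in terms of the centre `z`, the half-difference `h` of the two outer
points and the offset `w` of their midpoint from `z`. -/
noncomputable def doubling (M N : ℝ) (v : E n → ℝ) (y : E n × E n × E n) : ℝ :=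
  v (y.1 + y.2.2 + y.2.1) + v (y.1 + y.2.2 - y.2.1) - 2 * v y.1 - penalty M N y.2.1 y.2.2

/-- The slope `4 * R` of the penalty in `w` beats the linear growth `2⟪c, w⟫` of the doubled
function. -/
theorem doubling_le {B : ℝ}
    (hB : ∀ x, ‖v x - inner ℝ c x‖ ≤ B) {M R : ℝ} (hR : ‖c‖ + 1 ≤ R) (z h w : E n) :
    doubling M (4 * R) v (z, h, w) ≤ 4 * B - 2 * ‖w‖ - M * ‖h‖ ^ 2 / 2 := by
  have h1 := (abs_le.1 (hB (z + w + h))).2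
  have h2 := (abs_le.1 (hB (z + w - h))).2
  have h3 := (abs_le.1 (hB z)).1
  have h4 := real_inner_le_norm c w
  have h5 := le_penalty_left M (4 * R) h w
  have h6 := le_penalty_right M (4 * R) h w
  have h7 : (‖c‖ + 1) * ‖w‖ ≤ R * ‖w‖ := by gcongr
  simp only [inner_add_right, inner_sub_right] at h1 h2
  simp only [doubling]
  linarith

/-- The momenta at a positive maximum of the doubling functional. The penalty depends on the three
points only through `h` and `w`, which makes the momentum at the centre the exact average of the
two outer ones. -/
theorem mem_superdiff_of_doubling_max {M N : ℝ} {z h w : E n} (hpos : 0 < penalty M N h w)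
    (hmax : ∀ y', doubling M N v y' ≤ doubling M N v (z, h, w)) :
    (N ^ 2 / (2 * penalty M N h w)) • w + (M ^ 2 * ‖h‖ ^ 2 / penalty M N h w) • h
        ∈ superdiff v (z + w + h) ∧
      (N ^ 2 / (2 * penalty M N h w)) • w - (M ^ 2 * ‖h‖ ^ 2 / penalty M N h w) • h
        ∈ superdiff v (z + w - h) ∧
      (N ^ 2 / (2 * penalty M N h w)) • w ∈ subdiff v z := by
  refine ⟨?_, ?_, ?_⟩
  · refine mem_superdiff_of_hasFDerivAt
      ((hasFDerivAt_penalty hpos (1 / 2) (1 / 2)).congr_fderiv ?_) (Eventually.of_forall fun d => ?_)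
    · congr 1
      match_scalars <;> field_simp
    · have := hmax (z, h + (1 / 2 : ℝ) • d, w + (1 / 2 : ℝ) • d)
      simp only [doubling] at this
      rw [show z + (w + (1 / 2 : ℝ) • d) + (h + (1 / 2 : ℝ) • d) = z + w + h + d by module,
        show z + (w + (1 / 2 : ℝ) • d) - (h + (1 / 2 : ℝ) • d) = z + w - h by module] at this
      simp only [smul_zero, add_zero]
      linarith
  · refine mem_superdiff_of_hasFDerivAt
      ((hasFDerivAt_penalty hpos (-(1 / 2)) (1 / 2)).congr_fderiv ?_)
      (Eventually.of_forall fun d => ?_)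
    · congr 1
      match_scalars <;> field_simp
    · have := hmax (z, h + (-(1 / 2) : ℝ) • d, w + (1 / 2 : ℝ) • d)
      simp only [doubling] at this
      rw [show z + (w + (1 / 2 : ℝ) • d) + (h + (-(1 / 2) : ℝ) • d) = z + w + h by module,
        show z + (w + (1 / 2 : ℝ) • d) - (h + (-(1 / 2) : ℝ) • d) = z + w - h + d by module] at this
      simp only [smul_zero, add_zero]
      linarith
  · refine mem_subdiff_of_hasFDerivAt
      (((hasFDerivAt_penalty hpos 0 (-1)).const_mul (-(1 / 2))).congr_fderiv ?_)
      (Eventually.of_forall fun d => ?_)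
    · rw [← map_smul]
      congr 1
      match_scalars <;> field_simp
      ring
    · have := hmax (z + d, h + (0 : ℝ) • d, w + (-1 : ℝ) • d)
      simp only [doubling] at this
      rw [show z + d + (w + (-1 : ℝ) • d) + (h + (0 : ℝ) • d) = z + w + h by module,
        show z + d + (w + (-1 : ℝ) • d) - (h + (0 : ℝ) • d) = z + w - h by module] at this
      simp only [smul_zero, add_zero]
      linarith

namespace IsLiftedSolution

/-- The doubling functional attains its supremum as soon as it is positive somewhere: it is
periodic in `z` and tends to `-∞` in `(h, w)`. -/
theorem exists_doubling_max (hv : IsLiftedSolution A V c a v) {M R : ℝ} (hM : 1 ≤ M)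
    (hR : ‖c‖ + 1 ≤ R) {y₀ : E n × E n × E n} (h₀ : 0 < doubling M (4 * R) v y₀) :
    ∃ y, 0 < doubling M (4 * R) v y ∧ ∀ y', doubling M (4 * R) v y' ≤ doubling M (4 * R) v y := by
  obtain ⟨B, hB0, hB⟩ := hv.periodic.exists_norm_le (hv.continuous.sub (by fun_prop))
  obtain ⟨K, hK, hcov⟩ := exists_isCompact_fundamental n
  set ρ := 8 * B + 1
  have hS := hK.prod ((isCompact_closedBall (0 : E n) ρ).prod (isCompact_closedBall (0 : E n) ρ))
  have hcont : Continuous (doubling M (4 * R) v) := by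
    have hc := hv.continuous
    have h1 : Continuous fun y : E n × E n × E n => penalty M (4 * R) y.2.1 y.2.2 :=
      (continuous_penalty M (4 * R)).comp continuous_snd
    unfold doubling
    fun_prop
  have hshift : ∀ y, 0 < doubling M (4 * R) v y →
      ∃ y' ∈ K ×ˢ (closedBall (0 : E n) ρ ×ˢ closedBall (0 : E n) ρ),
        doubling M (4 * R) v y' = doubling M (4 * R) v y := by
    rintro ⟨z, h, w⟩ hpos
    have hle := doubling_le hB (M := M) hR z h w
    have h1 : ‖h‖ ^ 2 ≤ M * ‖h‖ ^ 2 := le_mul_of_one_le_left (by positivity) hM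
    have h2 : 0 ≤ ‖w‖ := norm_nonneg w
    have h3 : 0 ≤ ‖h‖ ^ 2 := by positivity
    obtain ⟨k, hk⟩ := hcov z
    refine ⟨(z + WithLp.toLp 2 (fun i => (k i : ℝ)), h, w), ⟨hk, ?_, ?_⟩, ?_⟩
    · rw [mem_closedBall_zero_iff]
      nlinarith [sq_nonneg (‖h‖ - 1)]
    · rw [mem_closedBall_zero_iff]
      simp only [ρ]
      linarith
    · set e : E n := WithLp.toLp 2 (fun i => (k i : ℝ)) with he
      have p1 := hv.periodic (z + w + h) k
      have p2 := hv.periodic (z + w - h) k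
      have p3 := hv.periodic z k
      simp only [← he, inner_add_right, inner_sub_right] at p1 p2 p3
      simp only [doubling]
      rw [show z + e + w + h = z + w + h + e by abel, show z + e + w - h = z + w - h + e by abel]
      linarith
  obtain ⟨y₁, hy₁, e₁⟩ := hshift y₀ h₀
  obtain ⟨y, -, hmax⟩ := hS.exists_isMaxOn ⟨y₁, hy₁⟩ hcont.continuousOn
  have hpos : 0 < doubling M (4 * R) v y := by
    have := hmax hy₁
    simp only [Set.mem_ofPred_eq] at this
    linarith
  refine ⟨y, hpos, fun y' => ?_⟩
  rcases le_or_gt (doubling M (4 * R) v y') 0 with h | h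
  · exact h.trans hpos.le
  · obtain ⟨y₂, hy₂, e₂⟩ := hshift y' h
    rw [← e₂]
    exact hmax hy₂

/-- Viscosity solutions are semiconcave. Were the doubling functional positive somewhere, its
maximum would produce momenta `q ± r` and `q` whose equations force `‖r‖² ≲ (1 + M)‖h‖²` by uniform
convexity, whereas the penalty gives `‖r‖ ≥ M‖h‖ / 2`. -/
theorem exists_isSemiconcave (hA : IsPeriodicMetric A) (hV : ContDiff ℝ ∞ V)
    (hVper : IsZPeriodic V) (hv : IsLiftedSolution A V c a v) :
    ∃ C : ℝ, 0 ≤ C ∧ IsSemiconcave C v := by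
  obtain ⟨R₀, hR₀⟩ := hA.exists_norm_le_of_hamiltonian_le hV.continuous hVper a
  obtain ⟨l, C, hl, hC0, hkey⟩ := hA.exists_sq_norm_le hV hVper
  set R := max R₀ (‖c‖ + 1)
  have hRc : ‖c‖ + 1 ≤ R := le_max_right _ _
  have hR1 : 1 ≤ R := by linarith [norm_nonneg c]
  -- the equations will give `l * M ^ 2 / 4 ≤ 2 * D * M`, which the choice of `M` excludes
  set D := C * (R ^ 2 + 1 + R) with hD
  have hD0 : 0 ≤ D := by positivity
  set M := 8 * D / l + 1 with hMdef
  have hM1 : 1 ≤ M := by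
    have : 0 ≤ 8 * D / l := by positivity
    linarith
  refine ⟨M, by linarith, fun z₀ h₀ => ?_⟩
  by_contra! hcon
  obtain ⟨⟨z, h, w⟩, hpos, hmax⟩ := hv.exists_doubling_max hM1 hRc (y₀ := (z₀, h₀, 0)) (by
    have := penalty_le (by linarith : 0 ≤ M) (by linarith : 0 ≤ 4 * R) h₀ 0
    simp only [doubling, add_zero]
    simp only [norm_zero, mul_zero, add_zero] at this
    linarith)
  set P := penalty M (4 * R) h w with hP
  have hPle : P ≤ M * ‖h‖ ^ 2 + 4 * R * ‖w‖ := penalty_le (by linarith) (by linarith) h w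
  have hPge : M * ‖h‖ ^ 2 ≤ P := le_penalty_left M (4 * R) h w
  have hPpos : 0 < P := by
    refine lt_of_le_of_ne (Real.sqrt_nonneg _) fun h0 => hpos.ne' ?_
    -- a vanishing penalty forces the three points to coincide
    have hh : ‖h‖ ^ 2 ≤ 0 := by
      have : ‖h‖ ^ 2 ≤ M * ‖h‖ ^ 2 := le_mul_of_one_le_left (by positivity) hM1
      linarith
    have hw : ‖w‖ ≤ 0 := by
      have := le_penalty_right M (4 * R) h w
      have : ‖w‖ ≤ 4 * R * ‖w‖ := le_mul_of_one_le_left (norm_nonneg w) (by linarith)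
      linarith
    have hh' : h = 0 := by simpa using hh
    have hw' : w = 0 := by simpa using hw
    simp only [doubling, ← hP, ← h0]
    rw [hh', hw']
    simp only [add_zero, sub_zero]
    ring
  obtain ⟨hx, hy, hz⟩ := mem_superdiff_of_doubling_max hPpos hmax
  rw [← hP] at hx hy hz
  set q := ((4 * R) ^ 2 / (2 * P)) • w with hq
  set r := (M ^ 2 * ‖h‖ ^ 2 / P) • h with hr
  have Hx := hv.subsolution _ _ hx
  have Hy := hv.subsolution _ _ hy
  have hqR : ‖q‖ ≤ R := by
    have h1 := (hR₀ _ _ Hx).trans (le_max_left R₀ (‖c‖ + 1))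
    have h2 := (hR₀ _ _ Hy).trans (le_max_left R₀ (‖c‖ + 1))
    have h3 : q = (1 / 2 : ℝ) • ((q + r) + (q - r)) := by module
    rw [h3, norm_smul, Real.norm_of_nonneg (by norm_num : (0 : ℝ) ≤ 1 / 2)]
    have := norm_add_le (q + r) (q - r)
    linarith
  -- `‖q‖ ≤ R` reads `8 * R * ‖w‖ ≤ P`, so `w` contributes at most half of the penalty
  have hw : 4 * R * ‖w‖ ≤ M * ‖h‖ ^ 2 := by
    rw [hq, norm_smul, Real.norm_of_nonneg (by positivity), div_mul_eq_mul_div,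
      div_le_iff₀ (by positivity)] at hqR
    have : 8 * R * ‖w‖ ≤ P := by
      refine le_of_mul_le_mul_left ?_ (by linarith : 0 < 2 * R)
      linarith
    linarith
  have hh : 0 < ‖h‖ := by
    refine lt_of_le_of_ne (norm_nonneg h) fun h0 => ?_
    rw [← h0] at hPle hw
    norm_num at hPle hw
    linarith
  have hrn : ‖r‖ = M ^ 2 * ‖h‖ ^ 3 / P := by
    rw [hr, norm_smul, Real.norm_of_nonneg (by positivity)]
    ring
  have hr1 : M * ‖h‖ / 2 ≤ ‖r‖ := by
    rw [hrn, le_div_iff₀ hPpos]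
    calc M * ‖h‖ / 2 * P ≤ M * ‖h‖ / 2 * (2 * (M * ‖h‖ ^ 2)) := by gcongr; linarith
      _ = _ := by ring
  have hr2 : ‖r‖ ≤ M * ‖h‖ := by
    rw [hrn, div_le_iff₀ hPpos]
    calc M ^ 2 * ‖h‖ ^ 3 = M * ‖h‖ * (M * ‖h‖ ^ 2) := by ring
      _ ≤ _ := by gcongr
  have hw' : ‖w‖ ≤ M * ‖h‖ ^ 2 := by
    have : ‖w‖ ≤ 4 * R * ‖w‖ := le_mul_of_one_le_left (norm_nonneg w) (by linarith)
    linarith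
  have main := hkey a z h w q r Hx Hy (hv.supersolution _ _ hz)
  have up : C * ((‖h‖ ^ 2 + ‖w‖) * (‖q‖ ^ 2 + 1) + ‖h‖ * ‖q‖ * ‖r‖)
      ≤ 2 * D * M * ‖h‖ ^ 2 := by
    have hM' : ‖h‖ ^ 2 ≤ M * ‖h‖ ^ 2 := le_mul_of_one_le_left (by positivity) hM1
    calc _ ≤ C * ((M * ‖h‖ ^ 2 + M * ‖h‖ ^ 2) * (R ^ 2 + 1) + ‖h‖ * R * (M * ‖h‖)) := by gcongr
      _ ≤ C * ((M * ‖h‖ ^ 2 + M * ‖h‖ ^ 2) * (R ^ 2 + 1) + 2 * (‖h‖ * R * (M * ‖h‖))) := by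
        have : 0 ≤ ‖h‖ * R * (M * ‖h‖) := by positivity
        refine mul_le_mul_of_nonneg_left ?_ hC0
        linarith
      _ = _ := by rw [hD]; ring
  have low : l * (M * ‖h‖ / 2) ^ 2 ≤ l * ‖r‖ ^ 2 := by gcongr
  have fin : l * M * (M * ‖h‖ ^ 2) ≤ 8 * D * (M * ‖h‖ ^ 2) := by linarith
  have := le_of_mul_le_mul_right fin (by positivity)
  rw [hMdef, mul_add, mul_div_cancel₀ _ hl.ne'] at this
  linarith

end IsLiftedSolution

end Solutions

/-! ### Level sets of semiconcave functions -/

section LevelSets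

/-- A function that is strictly increasing at a definite rate in the last variable and Lipschitz in
the others has Lipschitz graphs as level sets, locally. -/
theorem exists_lipschitz_implicit {F : Type*} [NormedAddCommGroup F] {B : F × ℝ → ℝ} {z₀ : F}
    {t₀ r m L : ℝ} (hB : Continuous B) (hr : 0 < r) (hm : 0 < m) (hL : 0 ≤ L)
    (hmono : ∀ z ∈ ball z₀ r, ∀ t ∈ ball t₀ r, ∀ t' ∈ ball t₀ r, t ≤ t' →
      B (z, t) + m * (t' - t) ≤ B (z, t'))
    (hlip : ∀ z ∈ ball z₀ r, ∀ z' ∈ ball z₀ r, ∀ t ∈ ball t₀ r,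
      B (z, t) - B (z', t) ≤ L * ‖z - z'‖) :
    ∃ U ∈ 𝓝 (z₀, t₀), ∃ f : F → ℝ, ∃ K : ℝ≥0, LipschitzWith K f ∧
      ∀ y ∈ U, (B y = B (z₀, t₀) ↔ y.2 = f y.1) := by
  -- over the ball of radius `r₁`, horizontal variation `L * r₁` is dominated by the vertical gain
  -- `m * r / 2`, so that the level is attained on every vertical segment
  set r₁ := min r (m * r / (2 * (L + 1))) with hr₁
  have hr₁0 : 0 < r₁ := lt_min hr (by positivity)
  have hr₁r : r₁ ≤ r := min_le_left _ _
  have hLr : L * r₁ < m * (r / 2) := by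
    have h1 : L * r₁ < (L + 1) * r₁ := by linarith
    have h2 : (L + 1) * r₁ ≤ (L + 1) * (m * r / (2 * (L + 1))) := by
      gcongr
      exact min_le_right _ _
    have h3 : (L + 1) * (m * r / (2 * (L + 1))) = m * (r / 2) := by field_simp
    linarith
  have hz₀ : z₀ ∈ ball z₀ r := mem_ball_self hr
  have ht₀ : t₀ ∈ ball t₀ r := mem_ball_self hr
  have hIcc : ∀ t ∈ Set.Icc (t₀ - r / 2) (t₀ + r / 2), t ∈ ball t₀ r := by
    intro t ht
    rw [Real.ball_eq_Ioo]
    exact ⟨by linarith [ht.1], by linarith [ht.2]⟩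
  have hm' : t₀ - r / 2 ∈ ball t₀ r := hIcc _ ⟨le_rfl, by linarith⟩
  have hp' : t₀ + r / 2 ∈ ball t₀ r := hIcc _ ⟨by linarith, le_rfl⟩
  have hex : ∀ z ∈ ball z₀ r₁, ∃ t ∈ Set.Icc (t₀ - r / 2) (t₀ + r / 2),
      B (z, t) = B (z₀, t₀) := by
    intro z hz
    have hzr : z ∈ ball z₀ r := ball_subset_ball hr₁r hz
    have hd : L * ‖z₀ - z‖ ≤ L * r₁ := by
      rw [mem_ball, dist_eq_norm, norm_sub_rev] at hz
      gcongr
    have l1 := hlip z₀ hz₀ z hzr _ hp'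
    have l2 := hlip z hzr z₀ hz₀ _ hm'
    rw [norm_sub_rev] at l2
    have m1 := hmono z₀ hz₀ _ ht₀ _ hp' (by linarith)
    have m2 := hmono z₀ hz₀ _ hm' _ ht₀ (by linarith)
    rw [add_sub_cancel_left] at m1
    rw [sub_sub_cancel] at m2
    have := intermediate_value_Icc (f := fun t => B (z, t)) (by linarith : t₀ - r / 2 ≤ t₀ + r / 2)
      (by fun_prop)
    exact this ⟨by linarith, by linarith⟩
  choose! g hg hgB using hex
  have hgL : LipschitzOnWith (Real.toNNReal (L / m)) g (ball z₀ r₁) := by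
    refine LipschitzOnWith.of_le_add_mul _ fun z hz z' hz' => ?_
    rw [Real.coe_toNNReal _ (by positivity), dist_eq_norm]
    rcases le_total (g z) (g z') with h | h
    · have : 0 ≤ L / m * ‖z - z'‖ := by positivity
      linarith
    · have h1 := hmono z' (ball_subset_ball hr₁r hz') _ (hIcc _ (hg z' hz')) _ (hIcc _ (hg z hz)) h
      have h2 := hlip z' (ball_subset_ball hr₁r hz') z (ball_subset_ball hr₁r hz) _
        (hIcc _ (hg z hz))
      rw [hgB z' hz'] at h1
      rw [hgB z hz, norm_sub_rev] at h2
      have h3 : g z - g z' ≤ L * ‖z - z'‖ / m := by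
        rw [le_div_iff₀ hm]
        linarith
      rw [mul_div_right_comm] at h3
      linarith
  obtain ⟨f, hf, hfg⟩ := hgL.extend_real
  refine ⟨ball z₀ r₁ ×ˢ ball t₀ r, prod_mem_nhds (ball_mem_nhds _ hr₁0) (ball_mem_nhds _ hr),
    f, _, hf, ?_⟩
  rintro ⟨z, t⟩ ⟨hz, ht⟩
  simp only at hz ht ⊢
  rw [← hfg hz]
  refine ⟨fun h => ?_, fun h => by rw [h, hgB z hz]⟩
  have hzr := ball_subset_ball hr₁r hz
  have hgz := hIcc _ (hg z hz)
  have hBz := hgB z hz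
  rcases le_total t (g z) with h' | h'
  · have := hmono z hzr t ht _ hgz h'
    have : m * (g z - t) ≤ 0 := by linarith
    have := nonpos_of_mul_nonpos_right this hm
    linarith
  · have := hmono z hzr _ hgz t ht h'
    have : m * (t - g z) ≤ 0 := by linarith
    have := nonpos_of_mul_nonpos_right this hm
    linarith

variable {n : ℕ} {v : E n → ℝ} {C : ℝ}

/-- Linear coordinates in which the direction `e` becomes the vertical one. -/
theorem exists_straightening (hn : 1 ≤ n) {e : E n} (he : e ≠ 0) :
    ∃ T : E n ≃L[ℝ] (E (n - 1) × ℝ), T.symm (0, 1) = e := by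
  let T₀ : E n ≃L[ℝ] (E (n - 1) × ℝ) := ContinuousLinearEquiv.ofFinrankEq (by
    rw [Module.finrank_prod]
    simp
    omega)
  have h0 : T₀.symm (0, 1) ≠ 0 := by simp
  obtain ⟨S, hS⟩ := SeparatingDual.exists_continuousLinearEquiv_apply_eq (R := ℝ) he h0
  refine ⟨S.trans T₀, ?_⟩
  simp [← hS]

namespace IsSemiconcave

theorem isClosed_superdiff (hC : IsSemiconcave C v) (hC0 : 0 ≤ C) (hv : Continuous v) (x : E n) :
    IsClosed (superdiff v x) :=
  IsSeqClosed.isClosed fun _ _ hps hp =>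
    hC.mem_superdiff_of_tendsto hC0 hv hps tendsto_const_nhds hp

/-- If `0` is not a supergradient at `x`, then it is separated from all supergradients at points
near `x` by one hyperplane. -/
theorem exists_uniform_direction (hC : IsSemiconcave C v) (hC0 : 0 ≤ C) (hv : Continuous v)
    {R : ℝ} (hR : ∀ y, ∀ p ∈ superdiff v y, ‖p‖ ≤ R) {x : E n} (hx : 0 ∉ superdiff v x) :
    ∃ e : E n, e ≠ 0 ∧ ∃ δ > 0, ∃ ρ > 0, ∀ y ∈ ball x ρ, ∀ p ∈ superdiff v y, δ ≤ inner ℝ p e := by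
  obtain ⟨f, δ, hδ, hf⟩ := geometric_hahn_banach_point_closed (convex_superdiff x)
    (hC.isClosed_superdiff hC0 hv x) hx
  rw [map_zero] at hδ
  set e := (InnerProductSpace.toDual ℝ (E n)).symm f
  have hfe : ∀ p, f p = inner ℝ p e := fun p => by
    rw [real_inner_comm, InnerProductSpace.toDual_symm_apply]
  refine ⟨e, fun he => ?_, δ, hδ, ?_⟩
  · obtain ⟨p, hp⟩ := hC.superdiff_nonempty hC0 hv hR x
    have := hf p hp
    rw [hfe, he, inner_zero_right] at this
    linarith
  · by_contra! hcon
    choose ys hys ps hps hlt using fun k : ℕ => hcon (1 / ((k : ℝ) + 1)) (by positivity)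
    have hlim : Tendsto ys atTop (𝓝 x) := by
      rw [tendsto_iff_dist_tendsto_zero]
      exact squeeze_zero (fun _ => dist_nonneg) (fun k => (mem_ball.1 (hys k)).le)
        tendsto_one_div_add_atTop_nhds_zero_nat
    obtain ⟨p, hp, φ, -, hφ⟩ := hC.exists_tendsto_mem_superdiff hC0 hv hR hps hlim
    have h1 := hf p hp
    have h2 : inner ℝ p e ≤ δ :=
      le_of_tendsto' (hφ.inner tendsto_const_nhds) fun k => (hlt (φ k)).le
    rw [hfe] at h1
    linarith

/-- At a point where `0` is not a supergradient, the level set is a Lipschitz hypersurface. -/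
theorem isLipschitzHypersurfaceNear (hn : 1 ≤ n) (hC : IsSemiconcave C v) (hC0 : 0 ≤ C)
    (hv : Continuous v) {R : ℝ} (hR : ∀ y, ∀ p ∈ superdiff v y, ‖p‖ ≤ R) {x : E n}
    (hx : 0 ∉ superdiff v x) : IsLipschitzHypersurfaceNear (levelSet v x) x := by
  obtain ⟨e, he, δ, hδ, ρ, hρ, hdir⟩ := hC.exists_uniform_direction hC0 hv hR hx
  obtain ⟨T, hT⟩ := exists_straightening hn he
  have hne := hC.superdiff_nonempty hC0 hv hR
  have hR0 : 0 ≤ R := by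
    obtain ⟨p, hp⟩ := hne x
    exact (norm_nonneg p).trans (hR x p hp)
  have hmove : ∀ z t t', T.symm (z, t) = T.symm (z, t') + (-(t' - t)) • e := by
    intro z t t'
    rw [← hT, ← map_smul, ← map_add]
    simp
  obtain ⟨r₀, hr₀, hball⟩ := Metric.mem_nhds_iff.1
    (T.symm.continuous.continuousAt (x := T x) |>.preimage_mem_nhds
      (by rw [T.symm_apply_apply]; exact ball_mem_nhds x hρ))
  -- steps along `e` shorter than `2 * r` are too short for the quadratic error to matter
  set r := min r₀ (δ / (2 * (C * ‖e‖ ^ 2 + 1))) with hr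
  have hr0 : 0 < r := lt_min hr₀ (by positivity)
  have hCr : C * ‖e‖ ^ 2 * r ≤ δ / 2 := by
    have h1 : r ≤ δ / (2 * (C * ‖e‖ ^ 2 + 1)) := min_le_right _ _
    rw [le_div_iff₀ (by positivity)] at h1
    linarith
  have hin : ∀ z ∈ ball (T x).1 r, ∀ t ∈ ball (T x).2 r, T.symm (z, t) ∈ ball x ρ := by
    intro z hz t ht
    refine hball ?_
    rw [mem_ball, Prod.dist_eq]
    exact max_lt (hz.trans_le (min_le_left _ _)) (ht.trans_le (min_le_left _ _))
  have key := exists_lipschitz_implicit (B := fun y => v (T.symm y)) (z₀ := (T x).1)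
    (t₀ := (T x).2) (r := r) (m := δ / 2)
    (L := (R + C / 2 * (2 * ρ)) * ‖(T.symm : E (n - 1) × ℝ →L[ℝ] E n)‖)
    (hv.comp T.symm.continuous) hr0 (by positivity) (by positivity) ?_ ?_
  · obtain ⟨U, hU, f, K, hf, hUf⟩ := key
    refine ⟨rfl, T, T ⁻¹' U, T.continuous.continuousAt.preimage_mem_nhds hU, f, K, hf,
      fun y hy => ?_⟩
    simpa [levelSet] using hUf (T y) hy
  · intro z hz t ht t' ht' htt'
    obtain ⟨p, hp⟩ := hne (T.symm (z, t'))
    have h1 := hC.le_of_mem_superdiff hC0 hp ((-(t' - t)) • e)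
    have h2 := hdir _ (hin z hz t' ht') p hp
    rw [← hmove, inner_smul_right, norm_smul, norm_neg,
      Real.norm_of_nonneg (sub_nonneg.2 htt')] at h1
    have h3 : t' - t ≤ 2 * r := by
      rw [Real.ball_eq_Ioo] at ht ht'
      linarith [ht.1, ht'.2]
    have h4 : 0 ≤ t' - t := sub_nonneg.2 htt'
    have h5 : (t' - t) * δ ≤ (t' - t) * inner ℝ p e := by gcongr
    have h6 : C / 2 * ((t' - t) * ‖e‖) ^ 2 ≤ (t' - t) * (δ / 2) := by
      calc C / 2 * ((t' - t) * ‖e‖) ^ 2 = (t' - t) * (C / 2 * ‖e‖ ^ 2 * (t' - t)) := by ring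
        _ ≤ (t' - t) * (C / 2 * ‖e‖ ^ 2 * (2 * r)) := by gcongr
        _ = (t' - t) * (C * ‖e‖ ^ 2 * r) := by ring
        _ ≤ _ := by gcongr
    linarith
  · intro z hz z' hz' t ht
    obtain ⟨p, hp⟩ := hne (T.symm (z', t))
    have h1 := hC.le_of_mem_superdiff hC0 hp (T.symm (z, t) - T.symm (z', t))
    rw [add_sub_cancel] at h1
    set d := T.symm (z, t) - T.symm (z', t) with hd
    have h2 : ‖d‖ ≤ ‖(T.symm : E (n - 1) × ℝ →L[ℝ] E n)‖ * ‖z - z'‖ := by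
      have : d = (T.symm : E (n - 1) × ℝ →L[ℝ] E n) (z - z', 0) := by
        rw [hd, ← map_sub]
        simp
      rw [this]
      refine (ContinuousLinearMap.le_opNorm _ _).trans_eq ?_
      simp [Prod.norm_mk]
    have h3 : ‖d‖ ≤ 2 * ρ := by
      have a1 := mem_ball.1 (hin z hz t ht)
      have a2 := mem_ball'.1 (hin z' hz' t ht)
      rw [hd, ← dist_eq_norm]
      linarith [dist_triangle (T.symm (z, t)) x (T.symm (z', t))]
    have h4 : inner ℝ p d ≤ R * ‖d‖ :=
      (real_inner_le_norm p d).trans (by gcongr; exact hR _ _ hp)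
    calc v (T.symm (z, t)) - v (T.symm (z', t)) ≤ R * ‖d‖ + C / 2 * ‖d‖ ^ 2 := by linarith
      _ = (R + C / 2 * ‖d‖) * ‖d‖ := by ring
      _ ≤ (R + C / 2 * (2 * ρ)) * (‖(T.symm : E (n - 1) × ℝ →L[ℝ] E n)‖ * ‖z - z'‖) := by gcongr
      _ = _ := by ring

end IsSemiconcave

/-- The part of a cylinder strictly on one side of a graph is connected if the graph does not meet
the bases of the cylinder: it is a continuous image of `ball × (0, 1)`. -/
theorem isPreconnected_cylinder_side {F : Type*} [NormedAddCommGroup F] [NormedSpace ℝ F]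
    {f : F → ℝ} (hf : Continuous f) {z₀ : F} {t₀ ρ s σ : ℝ} (hσ : σ = 1 ∨ σ = -1)
    (hfs : ∀ z ∈ ball z₀ ρ, |f z - t₀| < s) :
    IsPreconnected {y : F × ℝ | y.1 ∈ ball z₀ ρ ∧ |y.2 - t₀| < s ∧ 0 < σ * (y.2 - f y.1)} := by
  have hσ2 : σ * σ = 1 := by rcases hσ with rfl | rfl <;> norm_num
  have hσabs : ∀ t, σ * t ≤ |t| := by
    intro t
    rcases hσ with rfl | rfl
    · simpa using le_abs_self t
    · simpa using neg_le_abs t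
  have hS : IsPreconnected (ball z₀ ρ ×ˢ Set.Ioo (0 : ℝ) 1) :=
    (convex_ball z₀ ρ).isPreconnected.prod isPreconnected_Ioo
  convert hS.image (fun y => (y.1, f y.1 + y.2 * (t₀ + σ * s - f y.1)))
    (Continuous.continuousOn (by fun_prop)) using 1
  ext ⟨z, t⟩
  simp only [Set.mem_image, Set.mem_prod, Prod.exists, Prod.mk.injEq]
  constructor
  · rintro ⟨hz, ht, hpos⟩
    have hD : 0 < σ * (t₀ - f z) + s := by
      have := hσabs (f z - t₀)
      have := hfs z hz
      linarith
    refine ⟨z, σ * (t - f z) / (σ * (t₀ - f z) + s), ⟨hz, div_pos hpos hD, ?_⟩, rfl, ?_⟩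
    · rw [div_lt_one hD]
      have := hσabs (t - t₀)
      simp only at ht
      linarith
    · have e1 : t₀ + σ * s - f z = σ * (σ * (t₀ - f z) + s) := by
        linear_combination (f z - t₀) * hσ2
      rw [e1, div_mul_eq_mul_div, mul_left_comm, ← mul_assoc, mul_div_cancel_right₀ _ hD.ne']
      linear_combination (t - f z) * hσ2
  · rintro ⟨z, l, ⟨hz, hl0, hl1⟩, rfl, rfl⟩
    have h1 := hfs z hz
    have h2 := abs_lt.1 h1
    refine ⟨hz, ?_, ?_⟩
    · simp only
      rw [abs_lt]
      rcases hσ with rfl | rfl <;> constructor <;> nlinarith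
    · simp only
      have e1 : σ * (f z + l * (t₀ + σ * s - f z) - f z) = l * (σ * (t₀ - f z) + s) := by
        linear_combination l * s * hσ2
      rw [e1]
      have := hσabs (f z - t₀)
      exact mul_pos hl0 (by linarith)

/-- If the level set through `x` is a Lipschitz graph and `x` is not a local maximum point, then
`v` exceeds `v x` on one whole side of the graph, hence on an open truncated cone with vertex
`x`. -/
theorem exists_cone_lt_of_isLipschitzHypersurfaceNear (hv : Continuous v) {x : E n}
    (hS : IsLipschitzHypersurfaceNear (levelSet v x) x) (hmax : ¬ IsLocalMax v x) :
    ∃ e : E n, ∃ ε > 0, ∃ τ₀ > 0, ∀ d ∈ ball e ε, ∀ τ : ℝ, 0 < τ → τ < τ₀ →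
      v x < v (x + τ • d) := by
  obtain ⟨-, T, U, hU, f, K, hf, hUf⟩ := hS
  have hxf : (T x).2 = f (T x).1 := (hUf x (mem_of_mem_nhds hU)).1 rfl
  set z₀ := (T x).1
  set t₀ := (T x).2
  obtain ⟨s, hs, hball⟩ := Metric.mem_nhds_iff.1
    (T.symm.continuous.continuousAt (x := T x) |>.preimage_mem_nhds
      (by rw [T.symm_apply_apply]; exact hU))
  -- over the ball of radius `ρ` the graph stays strictly between the heights `t₀ - s` and `t₀ + s`
  set ρ := min s (s / (K + 1))
  have hρ : 0 < ρ := lt_min hs (by positivity)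
  have hρs : ρ ≤ s := min_le_left _ _
  have hfs : ∀ z ∈ ball z₀ ρ, |f z - t₀| < s := by
    intro z hz
    rw [hxf, ← Real.dist_eq]
    have h1 : ρ ≤ s / (K + 1) := min_le_right _ _
    rw [le_div_iff₀ (by positivity)] at h1
    calc dist (f z) (f z₀) ≤ K * dist z z₀ := hf.dist_le_mul z z₀
      _ ≤ K * ρ := by gcongr; exact (mem_ball.1 hz).le
      _ < s := by linarith
  let W : ℝ → Set (E (n - 1) × ℝ) := fun σ =>
    {y | y.1 ∈ ball z₀ ρ ∧ |y.2 - t₀| < s ∧ 0 < σ * (y.2 - f y.1)}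
  have hne : ∀ σ, ∀ y ∈ W σ, v (T.symm y) ≠ v x := by
    rintro σ y ⟨hy1, hy2, hy3⟩ h
    have hyU : T.symm y ∈ U := hball (by
      rw [mem_ball, Prod.dist_eq]
      exact max_lt (hy1.trans_le hρs) (by rwa [Real.dist_eq]))
    have := (hUf _ hyU).1 h
    rw [T.apply_symm_apply] at this
    rw [this, sub_self, mul_zero] at hy3
    exact hy3.false
  -- the side of the graph that contains a point where `v` exceeds `v x`
  obtain ⟨σ, hσ, y₁, hy₁, hvy₁⟩ : ∃ σ : ℝ, (σ = 1 ∨ σ = -1) ∧ ∃ y ∈ W σ, v x < v (T.symm y) := by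
    have hfr : ∃ᶠ y in 𝓝 x, v x < v y := by
      exact fun h => hmax (h.mono fun y hy => not_lt.1 hy)
    have hev : ∀ᶠ y in 𝓝 x, T y ∈ ball z₀ ρ ×ˢ ball t₀ s :=
      T.continuous.continuousAt.eventually
        (prod_mem_nhds (ball_mem_nhds _ hρ) (ball_mem_nhds _ hs))
    obtain ⟨y, hvy, hy1, hy2⟩ := (hfr.and_eventually hev).exists
    have hyU : y ∈ U := by
      have := hball (a := T y) (by
        rw [mem_ball, Prod.dist_eq]
        exact max_lt (hy1.trans_le hρs) hy2)
      simpa using this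
    have hyf : (T y).2 ≠ f (T y).1 := fun h => hvy.ne' ((hUf y hyU).2 h)
    rw [mem_ball, Real.dist_eq] at hy2
    rcases lt_or_gt_of_ne hyf with h | h
    · exact ⟨-1, Or.inr rfl, T y, ⟨hy1, hy2, by linarith⟩, by simpa using hvy⟩
    · exact ⟨1, Or.inl rfl, T y, ⟨hy1, hy2, by linarith⟩, by simpa using hvy⟩
  have hW : ∀ y ∈ W σ, v x < v (T.symm y) := by
    intro y hy
    by_contra! hle
    have hpre := (isPreconnected_cylinder_side hf.continuous hσ hfs).image (fun y => v (T.symm y))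
      (hv.comp T.symm.continuous).continuousOn
    obtain ⟨y', hy', h⟩ := hpre.Icc_subset ⟨y, hy, rfl⟩ ⟨y₁, hy₁, rfl⟩ ⟨hle, hvy₁.le⟩
    exact hne σ y' hy' h
  have hσ2 : σ * σ = 1 := by rcases hσ with rfl | rfl <;> norm_num
  have hσ1 : |σ| = 1 := by rcases hσ with rfl | rfl <;> norm_num
  have hev : ∀ᶠ d in 𝓝 (T.symm (0, σ)),
      K * ‖(T d).1‖ < σ * (T d).2 ∧ ‖(T d).1‖ < 1 ∧ |(T d).2| < 2 := by
    have c1 : Continuous fun d => K * ‖(T d).1‖ := by fun_prop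
    have c2 : Continuous fun d => σ * (T d).2 := by fun_prop
    have c3 : Continuous fun d => ‖(T d).1‖ := by fun_prop
    have c4 : Continuous fun d => |(T d).2| := by fun_prop
    refine (c1.continuousAt.eventually_lt c2.continuousAt ?_).and
      ((c3.continuousAt.eventually_lt continuousAt_const ?_).and
        (c4.continuousAt.eventually_lt continuousAt_const ?_))
    · simp [hσ2]
    · simp
    · simp [hσ1]
  obtain ⟨ε, hε, hεd⟩ := Metric.mem_nhds_iff.1 hev
  refine ⟨T.symm (0, σ), ε, hε, min ρ (s / 2), lt_min hρ (half_pos hs), fun d hd τ hτ hτ₀ => ?_⟩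
  obtain ⟨h1, h2, h3⟩ := hεd hd
  have hτρ := hτ₀.trans_le (min_le_left _ _)
  have hτs := hτ₀.trans_le (min_le_right _ _)
  have := hW (T (x + τ • d)) ?_
  · simpa using this
  · rw [map_add, map_smul]
    refine ⟨?_, ?_, ?_⟩
    · rw [mem_ball, dist_eq_norm]
      change ‖z₀ + τ • (T d).1 - z₀‖ < ρ
      rw [add_sub_cancel_left, norm_smul, Real.norm_of_nonneg hτ.le]
      calc τ * ‖(T d).1‖ ≤ τ * 1 := by gcongr
        _ < ρ := by linarith
    · change |t₀ + τ * (T d).2 - t₀| < s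
      rw [add_sub_cancel_left, abs_mul, abs_of_pos hτ]
      calc τ * |(T d).2| ≤ τ * 2 := by gcongr
        _ < s := by linarith
    · change 0 < σ * (t₀ + τ * (T d).2 - f (z₀ + τ • (T d).1))
      have h4 := hf.dist_le_mul (z₀ + τ • (T d).1) z₀
      rw [Real.dist_eq, dist_eq_norm, add_sub_cancel_left, norm_smul,
        Real.norm_of_nonneg hτ.le, ← hxf] at h4
      have h5 : σ * (f (z₀ + τ • (T d).1) - t₀) ≤ |f (z₀ + τ • (T d).1) - t₀| := by
        refine (le_abs_self _).trans_eq ?_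
        rw [abs_mul, hσ1, one_mul]
      have h6 : τ * (K * ‖(T d).1‖) < τ * (σ * (T d).2) := by gcongr
      linarith

/-- A critical point in the sense `0 ∈ D⁺v(x)` is incompatible with `v > v x` on an open cone with
vertex `x`, if subgradients stay away from zero: along points of subdifferentiability in the cone
the gradients have a nonzero limit `p ∈ D⁺v(x)`. The values in the cone are `v x + O(|y - x|²)`, so
`⟪p, e⟫ ≤ 0` on the axis `e`, whereas `v > v x` forces `⟪p, d⟫ ≥ 0` for all `d` in the cone. -/
theorem IsSemiconcave.zero_notMem_superdiff_of_cone (hC : IsSemiconcave C v) (hC0 : 0 ≤ C)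
    (hv : Continuous v) {R : ℝ} (hR : ∀ y, ∀ p ∈ superdiff v y, ‖p‖ ≤ R) {x : E n}
    (hsub : ∀ (ys ps : ℕ → E n) (p : E n), (∀ k, ps k ∈ subdiff v (ys k)) →
      Tendsto ys atTop (𝓝 x) → Tendsto ps atTop (𝓝 p) → p ≠ 0)
    {e : E n} {ε τ₀ : ℝ} (hε : 0 < ε) (hτ₀ : 0 < τ₀)
    (hcone : ∀ d ∈ ball e ε, ∀ τ : ℝ, 0 < τ → τ < τ₀ → v x < v (x + τ • d)) :
    0 ∉ superdiff v x := by
  intro h0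
  set θ : ℕ → ℝ := fun k => 1 / ((k : ℝ) + 1) with hθ
  have hθ0 : ∀ k, 0 < θ k := fun k => by positivity
  have hθlim : Tendsto θ atTop (𝓝 0) := tendsto_one_div_add_atTop_nhds_zero_nat
  choose ys hys ps hps using fun k : ℕ =>
    exists_mem_subdiff_near hv (x + θ k • e) (ε := θ k * θ k) (mul_pos (hθ0 k) (hθ0 k))
  set ds : ℕ → E n := fun k => (θ k)⁻¹ • (ys k - x) with hds
  have hyd : ∀ k, ys k = x + θ k • ds k := fun k => by
    rw [hds, smul_inv_smul₀ (hθ0 k).ne', add_sub_cancel]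
  have hdlim : Tendsto ds atTop (𝓝 e) := by
    rw [tendsto_iff_norm_sub_tendsto_zero]
    refine squeeze_zero (fun _ => norm_nonneg _) (fun k => ?_) hθlim
    have h1 := (mem_ball.1 (hys k)).le
    rw [dist_eq_norm, hyd k, show x + θ k • ds k - (x + θ k • e) = θ k • (ds k - e) by module,
      norm_smul, Real.norm_of_nonneg (hθ0 k).le] at h1
    exact le_of_mul_le_mul_left h1 (hθ0 k)
  have hylim : Tendsto ys atTop (𝓝 x) := by
    have : Tendsto (fun k => x + θ k • ds k) atTop (𝓝 (x + (0 : ℝ) • e)) :=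
      (hθlim.smul hdlim).const_add x
    rw [zero_smul, add_zero] at this
    exact this.congr fun k => (hyd k).symm
  have hps' : ∀ k, ps k ∈ superdiff v (ys k) := fun k => hC.subdiff_subset_superdiff _ (hps k)
  obtain ⟨p, hp, φ, hφ, hplim⟩ := hC.exists_tendsto_mem_superdiff hC0 hv hR hps' hylim
  have hp0 : p ≠ 0 := hsub (ys ∘ φ) (ps ∘ φ) p (fun k => hps (φ k))
    (hylim.comp hφ.tendsto_atTop) hplim
  have hstep : ∀ k, inner ℝ (ps k) (ds k) ≤ C * θ k * ‖ds k‖ ^ 2 ∨ v (ys k) ≤ v x := by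
    intro k
    by_cases hlt : v (ys k) ≤ v x
    · exact Or.inr hlt
    refine Or.inl ?_
    have h1 := hC.le_of_mem_superdiff hC0 (hps' k) (-(θ k • ds k))
    have h2 := hC.le_of_mem_superdiff hC0 h0 (θ k • ds k)
    rw [inner_zero_left, ← hyd k] at h2
    rw [show ys k + -(θ k • ds k) = x by rw [hyd k]; abel, inner_neg_right, norm_neg,
      inner_smul_right] at h1
    rw [norm_smul, Real.norm_of_nonneg (hθ0 k).le, mul_pow] at h1 h2
    have h3 : θ k * inner ℝ (ps k) (ds k) ≤ θ k * (C * θ k * ‖ds k‖ ^ 2) := by linarith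
    exact le_of_mul_le_mul_left h3 (hθ0 k)
  have hpe : inner ℝ p e ≤ 0 := by
    have hle : ∀ᶠ k in atTop, inner ℝ (ps k) (ds k) ≤ C * θ k * ‖ds k‖ ^ 2 := by
      filter_upwards [hdlim.eventually (ball_mem_nhds e hε), hθlim.eventually (gt_mem_nhds hτ₀)]
        with k hk1 hk2
      refine (hstep k).resolve_right (not_le.2 ?_)
      rw [hyd k]
      exact hcone _ hk1 _ (hθ0 k) hk2
    have hrhs : Tendsto (fun k => C * θ k * ‖ds k‖ ^ 2) atTop (𝓝 (C * 0 * ‖e‖ ^ 2)) :=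
      (hθlim.const_mul C).mul (hdlim.norm.pow 2)
    rw [mul_zero, zero_mul] at hrhs
    exact le_of_tendsto_of_tendsto (hplim.inner (hdlim.comp hφ.tendsto_atTop))
      (hrhs.comp hφ.tendsto_atTop) (hφ.tendsto_atTop.eventually hle)
  have hpd : ∀ d ∈ ball e ε, 0 ≤ inner ℝ p d := by
    intro d hd
    have hlim : Tendsto (fun τ : ℝ => inner ℝ p d + C / 2 * ‖d‖ ^ 2 * τ) (𝓝[>] 0)
        (𝓝 (inner ℝ p d + C / 2 * ‖d‖ ^ 2 * 0)) := by
      have : Continuous fun τ : ℝ => inner ℝ p d + C / 2 * ‖d‖ ^ 2 * τ := by fun_prop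
      exact (this.tendsto 0).mono_left nhdsWithin_le_nhds
    rw [mul_zero, add_zero] at hlim
    refine ge_of_tendsto hlim ?_
    filter_upwards [Ioo_mem_nhdsGT hτ₀] with τ hτ
    have h1 := hcone d hd τ hτ.1 hτ.2
    have h2 := hC.le_of_mem_superdiff hC0 hp (τ • d)
    rw [inner_smul_right, norm_smul, Real.norm_of_nonneg hτ.1.le, mul_pow] at h2
    refine le_of_mul_le_mul_left ?_ hτ.1
    linarith
  -- tilt the axis slightly against `p`
  have hpn : 0 < ‖p‖ := norm_pos_iff.2 hp0
  have hη : e - (ε / (2 * ‖p‖)) • p ∈ ball e ε := by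
    rw [mem_ball, dist_eq_norm, sub_sub_cancel_left, norm_neg, norm_smul,
      Real.norm_of_nonneg (by positivity)]
    have : ε / (2 * ‖p‖) * ‖p‖ = ε / 2 := by field_simp
    linarith
  have h1 := hpd _ hη
  rw [inner_sub_right, inner_smul_right, real_inner_self_eq_norm_sq] at h1
  have h2 : 0 < ε / (2 * ‖p‖) * ‖p‖ ^ 2 := by positivity
  linarith

variable {A : E n → Matrix (Fin n) (Fin n) ℝ} {V : E n → ℝ} {c : E n} {a : ℝ}

/-- Above the maximum of the potential, limits of subgradients of a solution do not vanish. -/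
theorem IsLiftedSolution.ne_zero_of_tendsto (hA : IsPeriodicMetric A) (hV : Continuous V)
    (hv : IsLiftedSolution A V c a v) {x : E n} (hVx : V x < a) (ys ps : ℕ → E n) (p : E n)
    (hps : ∀ k, ps k ∈ subdiff v (ys k)) (hy : Tendsto ys atTop (𝓝 x))
    (hp : Tendsto ps atTop (𝓝 p)) : p ≠ 0 := by
  rintro rfl
  have hcA := hA.contDiff_metricOp.continuous
  have hcH : Continuous fun y : E n × E n => hamiltonian A V y.1 y.2 := by
    simp only [hamiltonian_eq]
    fun_prop
  have h1 := (hcH.tendsto (x, 0)).comp (hy.prodMk_nhds hp)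
  simp only [hamiltonian_eq, inner_zero_right, mul_zero, zero_add] at h1
  exact absurd (ge_of_tendsto' h1 fun k => hv.supersolution _ _ (hps k)) (not_le.2 hVx)

end LevelSets

end MechHJ

open MechHJ in
theorem mainTheorem1 (n : ℕ) (hn : 2 ≤ n)
    (A : MechHJ.E n → Matrix (Fin n) (Fin n) ℝ) (hA : MechHJ.IsPeriodicMetric A)
    (V : MechHJ.E n → ℝ) (hV : ContDiff ℝ ∞ V) (hVper : MechHJ.IsZPeriodic V)
    (c : MechHJ.E n) (u : MechHJ.E n → ℝ) (hu : MechHJ.IsWeakKAMSolution A V c u)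
    (hsuper : (⨆ y, V y) < MechHJ.matherAlpha A V c)
    (v : MechHJ.E n → ℝ) (hv : ∀ y, v y = u y + inner ℝ c y)
    (x : MechHJ.E n) (hx : x ∈ MechHJ.singularSet v) :
    (0 : MechHJ.E n) ∉ MechHJ.superdiff v x ↔
      ¬ IsLocalMax v x ∧ MechHJ.IsLipschitzHypersurfaceNear (MechHJ.levelSet v x) x := by
  have hsol := IsPeriodicViscositySolution.isLiftedSolution hu hv
  have hcont := hsol.continuous
  obtain ⟨C, hC0, hC⟩ := hsol.exists_isSemiconcave hA hV hVper
  obtain ⟨R, hR⟩ := hA.exists_norm_le_of_hamiltonian_le hV.continuous hVper (matherAlpha A V c)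
  have hR' : ∀ y, ∀ p ∈ superdiff v y, ‖p‖ ≤ R := fun y p hp => hR y p (hsol.subsolution y p hp)
  have hVx : V x < matherAlpha A V c := by
    obtain ⟨B, -, hB⟩ := hVper.exists_norm_le hV.continuous
    refine (le_ciSup (f := V) ⟨B, ?_⟩ x).trans_lt hsuper
    rintro _ ⟨y, rfl⟩
    exact (le_abs_self _).trans (hB y)
  constructor
  · intro h0
    exact ⟨fun hmax => h0 (zero_mem_superdiff_of_isLocalMax hmax),
      hC.isLipschitzHypersurfaceNear (by omega) hC0 hcont hR' h0⟩
  · rintro ⟨hmax, hS⟩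
    obtain ⟨e, ε, hε, τ₀, hτ₀, hcone⟩ :=
      exists_cone_lt_of_isLipschitzHypersurfaceNear hcont hS hmax
    exact hC.zero_notMem_superdiff_of_cone hC0 hcont hR'
      (hsol.ne_zero_of_tendsto hA hV.continuous hVx) hε hτ₀ hcone
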